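/- Let $d\ge 2$, let $\mathcal L(\mathbb C^d)$ be the algebra of linear operators on $\mathbb C^d$, and put $m_1=-\frac1{d-1}$, $m_2=-\frac1{d^2-1}$. Let $\mathsf Q(x)=|\varphi_x\rangle\langle\varphi_x|$, $x\in\{0,\dots,d-1\}$, be the sharp meter associated with an orthonormal basis $\{\varphi_0,\dots,\varphi_{d-1}\}$ of $\mathbb C^d$, and for real $s,t$ let $$\mathsf Q_s(x)=s\,|\varphi_x\rangle\langle\varphi_x|+(1-s)\tfrac1d\mathbb 1,\qquad I_t(\rho)=t\,\rho+(1-t)\tfrac1d\,\mathrm{tr}(\rho)\,\mathbb 1 .$$ A channel is a linear completely positive map that sends every state (positive semidefinite operator of trace one) to an operator of trace one. An instrument is a family $\mathcal J(x,\cdot)$, $x\in\{0,\dots,d-1\}$, of linear completely positive maps on $\mathcal L(\mathbb C^d)$ whose sum $\sum_x\mathcal J(x,\cdot)$ is a channel; its adjoint $\mathcal J^\dagger$ is given by $\mathrm{tr}(\rho\,\mathcal J^\dagger(x,A))=\mathrm{tr}(\mathcal J(x,\rho)A)$. We say that $\mathsf Q_s$ and $I_t$ are compatible if there is an instrument $\mathcal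 J$ with $\mathcal J^\dagger(x,\mathbb 1)=\mathsf Q_s(x)$ for all $x$ and $\sum_x\mathcal J(x,\cdot)=I_t$. Theorem. Let $(s,t)\in[m_1,1]\times[m_2,1]$. Then $\mathsf Q_s$ and $I_t$ are compatible if and only if $$-2\Big[1-t_d+\sqrt{(1-d^2)t_d^2+(d^2-2)t_d+1}\Big]\;\le\; d^2 s\;\le\;(d^2-2)(1-t)+2\sqrt{(1-d^2)t^2+(d^2-2)t+1},$$ where $t_d=\frac{d-2}{2(d-1)}$ if $d\ge 3$ and $t\le\frac{d-2}{2(d-1)}$, and $t_d=t$ otherwise. In particular, $\mathsf Q_{m_1}$ and $I_{m_2}$ are compatible if and only if $d\ge 3$. -/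

import Mathlib

open scoped ComplexOrder

/-- The algebra of all linear operators on the qudit space `ℂ^d`, as matrices with respect to the
standard basis. -/
abbrev QOp (d : ℕ) : Type := Matrix (Fin d) (Fin d) ℂ

/-- States: positive semidefinite operators of trace one. -/
def IsState {d : ℕ} (ρ : QOp d) : Prop := ρ.PosSemidef ∧ ρ.trace = 1

/-- Complete positivity: for every `k`, applying `Φ` to all entries of a `k × k` block matrix over
`QOp d₁` sends positive semidefinite matrices to positive semidefinite matrices. -/
def IsCP {d₁ d₂ : ℕ} (Φ : QOp d₁ →ₗ[ℂ] QOp d₂) : Prop :=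
  ∀ (k : ℕ) (M : Matrix (Fin k) (Fin k) (QOp d₁)),
    (Matrix.comp (Fin k) (Fin k) (Fin d₁) (Fin d₁) ℂ M).PosSemidef →
    (Matrix.comp (Fin k) (Fin k) (Fin d₂) (Fin d₂) ℂ (M.map Φ)).PosSemidef

/-- Channels (Schrödinger picture). -/
def IsChannel {d₁ d₂ : ℕ} (Φ : QOp d₁ →ₗ[ℂ] QOp d₂) : Prop :=
  IsCP Φ ∧ ∀ ρ : QOp d₁, IsState ρ → (Φ ρ).trace = 1

/-- Instruments with outcomes in the finite set `X` (Schrödinger picture). -/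
def IsInstrument {X : Type*} [Fintype X] {d₁ d₂ : ℕ} (J : X → QOp d₁ →ₗ[ℂ] QOp d₂) : Prop :=
  (∀ x, IsCP (J x)) ∧ IsChannel (∑ x, J x)

/-- The adjoint (Heisenberg picture) `Φ†` of a linear map `Φ`. It is the unique map with
`tr (ρ Φ†(A)) = tr (Φ(ρ) A)`, see `trace_mul_heisenberg`. -/
def heisenberg {d₁ d₂ : ℕ} (Φ : QOp d₁ →ₗ[ℂ] QOp d₂) (A : QOp d₂) : QOp d₁ :=
  Matrix.of fun j i => (Φ (Matrix.single i j 1) * A).trace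

theorem trace_mul_heisenberg {d₁ d₂ : ℕ} (Φ : QOp d₁ →ₗ[ℂ] QOp d₂) (ρ : QOp d₁) (A : QOp d₂) :
    (ρ * heisenberg Φ A).trace = (Φ ρ * A).trace := by
  have h : Φ ρ = ∑ i, ∑ j, ρ i j • Φ (Matrix.single i j 1) := by
    conv_lhs => rw [Matrix.matrix_eq_sum_single ρ]
    simp only [map_sum, ← map_smul, Matrix.smul_single, smul_eq_mul, mul_one]
  rw [h]
  simp only [Finset.sum_mul, Matrix.trace_sum, Matrix.smul_mul, Matrix.trace_smul, smul_eq_mul]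
  rfl

/-- `J` is a joint instrument for the meter `M` and the channel `Φ`:
`J†(x, 1) = M(x)` for all `x`, and `∑ x, J(x, ·) = Φ`. -/
def IsJointInstrument {X : Type*} [Fintype X] {d : ℕ} (J : X → QOp d →ₗ[ℂ] QOp d)
    (M : X → QOp d) (Φ : QOp d →ₗ[ℂ] QOp d) : Prop :=
  IsInstrument J ∧ (∀ x, heisenberg (J x) 1 = M x) ∧ ∑ x, J x = Φ

/-- A meter and a channel are compatible if they admit a joint instrument. -/
def Compatible {X : Type*} [Fintype X] {d : ℕ} (M : X → QOp d) (Φ : QOp d →ₗ[ℂ] QOp d) : Prop :=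
  ∃ J : X → QOp d →ₗ[ℂ] QOp d, IsJointInstrument J M Φ

/-- The sharp meter `Q(x) = |φ_x⟩⟨φ_x|` associated with the orthonormal basis `φ` of `ℂ^d`. -/
noncomputable def sharpMeter {d : ℕ} (φ : OrthonormalBasis (Fin d) ℂ (EuclideanSpace ℂ (Fin d)))
    (x : Fin d) : QOp d :=
  Matrix.vecMulVec (fun i => φ x i) (fun j => star (φ x j))

/-- The noisy version `Q_s(x) = s Q(x) + (1 - s) (1/d) 1` of the sharp meter `Q`. -/
noncomputable def noisyMeter {d : ℕ} (φ : OrthonormalBasis (Fin d) ℂ (EuclideanSpace ℂ (Fin d)))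
    (s : ℝ) (x : Fin d) : QOp d :=
  (s : ℂ) • sharpMeter φ x + ((1 - s : ℂ) * (1 / d)) • (1 : QOp d)

/-- The depolarizing channel `I_t(ρ) = t ρ + (1 - t) (1/d) tr(ρ) 1`. -/
noncomputable def depolarizing (d : ℕ) (t : ℝ) : QOp d →ₗ[ℂ] QOp d :=
  (t : ℂ) • LinearMap.id +
    ((1 - t : ℂ) * (1 / d)) • (Matrix.traceLinearMap (Fin d) ℂ ℂ).smulRight (1 : QOp d)

theorem depolarizing_apply (d : ℕ) (t : ℝ) (ρ : QOp d) :
    depolarizing d t ρ = (t : ℂ) • ρ + ((1 - t : ℂ) * (1 / d)) • ρ.trace • (1 : QOp d) := rfl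

/-- The parameter `t_d`. -/
noncomputable def tD (d : ℕ) (t : ℝ) : ℝ :=
  if 3 ≤ d ∧ t ≤ ((d : ℝ) - 2) / (2 * ((d : ℝ) - 1)) then
    ((d : ℝ) - 2) / (2 * ((d : ℝ) - 1))
  else t

/-- The smallest admissible noise parameter `m₁ = -1/(d-1)` of a noisy sharp meter. -/
noncomputable def mOne (d : ℕ) : ℝ := -1 / ((d : ℝ) - 1)

/-- The smallest admissible noise parameter `m₂ = -1/(d²-1)` of a depolarizing channel. -/
noncomputable def mTwo (d : ℕ) : ℝ := -1 / ((d : ℝ) ^ 2 - 1)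

/-!
The Choi matrices `C x` of a joint instrument are positive semidefinite matrices on `ℂ^d ⊗ ℂ^d` with
sum `((1 - t) / d) 1 + t |Ω⟩⟨Ω|`, `Ω = ∑ i, e_i ⊗ e_i`, where by unitary covariance of the
depolarizing channel (`compatible_noisyMeter_iff`) the meter is the noisy meter of the standard basis.
Only the compression of `C x` to the span of the `e_i ⊗ e_i` and the diagonal entries at `e_i ⊗ e_j`,
`i ≠ j`, matter, and only their real parts: `compatible_iff_jointData` expresses compatibility
through such `JointData`. Conversely, joint data define an instrument made of entrywise
multiplications, completely positive by the Schur product theorem, and of measure-and-prepare maps.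

Let `c x` be the compressions and `F = ∑ x, c x x x`. Then `1 + (d - 1) s = F + N`, where `N` is the
weight off the diagonal span, so that `0 ≤ N ≤ (d - 1) (1 - t)`. Splitting `d e_x = 𝟙 + u x` with
`u x = d e_x - 𝟙` gives `d² F = P + 2 K + B`, where `P = 1 + (d² - 1) t` comes from `𝟙`, `B` from the
`u x`, and `K² ≤ P B` by the Cauchy-Schwarz inequality. The `2 × 2` minors of the `c x` yield
`B ≤ (d - 1)² (1 - t)`, with equality for `d = 2` (`JointData.exists_bounds`). Hence `d² F` lies between
`(√P - √B)²` and `(√P + √B)²`. The right end gives the upper bound on `s`. The left end gives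
the lower bound as soon as `√P ≥ (d - 1) √(1 - t)`, which is the condition
`t ≥ (d - 2) / (2 (d - 1))`, or if `d = 2`; otherwise the lower bound is `s ≥ m₁`.

For fixed `t` the admissible `s` form an interval (`JointData.convex`), so it suffices to attain the
end points. With `c x` the rank one operators given by the columns of a square root of
`((1 - t) / d) 1 + t 𝟙𝟙ᵀ` the relevant inequalities become equalities: the positive root gives the upper
end (`jointData_upper`), the root with a negative eigenvalue on the complement of `𝟙` the
lower one (`jointData_lower`). For `d ≥ 3` and small `t` there are `c x` which annihilate `e_x`, and
these give `s = m₁` (`jointData_mOne`).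
-/

open Matrix

/-! ### Completely positive maps -/

lemma IsCP.sum {ι : Type*} (s : Finset ι) {d₁ d₂ : ℕ} {Φ : ι → QOp d₁ →ₗ[ℂ] QOp d₂}
    (h : ∀ x ∈ s, IsCP (Φ x)) : IsCP (∑ x ∈ s, Φ x) := by
  intro k M hM
  have e : comp (Fin k) (Fin k) (Fin d₂) (Fin d₂) ℂ (M.map ⇑(∑ x ∈ s, Φ x)) =
      ∑ x ∈ s, comp (Fin k) (Fin k) (Fin d₂) (Fin d₂) ℂ (M.map (Φ x)) := by
    ext ⟨i, a⟩ ⟨j, b⟩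
    simp [comp_apply, Matrix.sum_apply]
  rw [e]
  exact posSemidef_sum s fun x hx => h x hx k M hM

lemma IsCP.add {d₁ d₂ : ℕ} {Φ Ψ : QOp d₁ →ₗ[ℂ] QOp d₂} (hΦ : IsCP Φ) (hΨ : IsCP Ψ) :
    IsCP (Φ + Ψ) := fun k M hM => (hΦ k M hM).add (hΨ k M hM)

lemma IsCP.comp {d₁ d₂ d₃ : ℕ} {Ψ : QOp d₂ →ₗ[ℂ] QOp d₃} {Φ : QOp d₁ →ₗ[ℂ] QOp d₂}
    (hΨ : IsCP Ψ) (hΦ : IsCP Φ) : IsCP (Ψ ∘ₗ Φ) :=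
  fun k M hM => hΨ k _ (hΦ k M hM)

/-- The map `ρ ↦ K ρ Kᴴ`. -/
def krausMap {d₁ d₂ : ℕ} (K : Matrix (Fin d₂) (Fin d₁) ℂ) : QOp d₁ →ₗ[ℂ] QOp d₂ where
  toFun ρ := K * ρ * Kᴴ
  map_add' a b := by rw [Matrix.mul_add, Matrix.add_mul]
  map_smul' a b := by simp

lemma krausMap_apply {d₁ d₂ : ℕ} (K : Matrix (Fin d₂) (Fin d₁) ℂ) (ρ : QOp d₁) :
    krausMap K ρ = K * ρ * Kᴴ := rfl

lemma isCP_krausMap {d₁ d₂ : ℕ} (K : Matrix (Fin d₂) (Fin d₁) ℂ) : IsCP (krausMap K) := by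
  intro k M hM
  -- The block diagonal matrix with all diagonal blocks equal to `K`.
  let B : Matrix (Fin k × Fin d₂) (Fin k × Fin d₁) ℂ :=
    of fun p q => if p.1 = q.1 then K p.2 q.2 else 0
  have e : Matrix.comp (Fin k) (Fin k) (Fin d₂) (Fin d₂) ℂ (M.map (krausMap K)) =
      B * Matrix.comp (Fin k) (Fin k) (Fin d₁) (Fin d₁) ℂ M * Bᴴ := by
    ext ⟨i, a⟩ ⟨j, b⟩
    simp [comp_apply, krausMap_apply, Matrix.mul_apply, Fintype.sum_prod_type, B,
      ite_mul, apply_ite]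
  rw [e]
  exact hM.mul_mul_conjTranspose_same B

/-- The map `ρ ↦ c ⊙ ρ` of entrywise multiplication by the matrix `c`. -/
def schurMap {d : ℕ} (c : QOp d) : QOp d →ₗ[ℂ] QOp d where
  toFun ρ := c ⊙ ρ
  map_add' a b := by ext i j; simp [mul_add]
  map_smul' a b := by ext i j; simp [mul_left_comm]

/-- By the Schur product theorem. -/
lemma isCP_schurMap {d : ℕ} {c : QOp d} (hc : c.PosSemidef) : IsCP (schurMap c) := by
  intro k M hM
  exact (hc.submatrix (Prod.snd : Fin k × Fin d → Fin d)).hadamard hM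

/-- The map which measures the standard basis and prepares the `j`-th basis
state with weight `n i j` upon the outcome `i`. -/
noncomputable def transitionMap {d : ℕ} (n : Fin d → Fin d → ℝ) : QOp d →ₗ[ℂ] QOp d :=
  ∑ i, ∑ j, krausMap (single j i ((√(n i j) : ℝ) : ℂ))

lemma isCP_transitionMap {d : ℕ} (n : Fin d → Fin d → ℝ) : IsCP (transitionMap n) :=
  .sum _ fun _ _ => .sum _ fun _ _ => isCP_krausMap _

lemma transitionMap_apply {d : ℕ} {n : Fin d → Fin d → ℝ} (hn : ∀ i j, 0 ≤ n i j) (ρ : QOp d) :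
    transitionMap n ρ = diagonal fun j => ∑ i, (n i j : ℂ) * ρ i i := by
  have h : ∀ i j, krausMap (single j i ((√(n i j) : ℝ) : ℂ)) ρ
      = single j j ((n i j : ℂ) * ρ i i) := by
    intro i j
    have : ((√(n i j) : ℝ) : ℂ) * ((√(n i j) : ℝ) : ℂ) = n i j := by
      rw [← Complex.ofReal_mul, Real.mul_self_sqrt (hn i j)]
    rw [krausMap_apply, conjTranspose_single, single_mul_mul_single]
    congr 1
    simp only [Complex.star_def, Complex.conj_ofReal]
    rw [← this]; ring
  ext a b
  simp only [transitionMap, LinearMap.sum_apply, h, Matrix.sum_apply, diagonal_apply]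
  by_cases hab : a = b
  · subst hab
    simp [single_apply]
  · simp only [hab, if_false]
    refine Finset.sum_eq_zero fun i _ => Finset.sum_eq_zero fun j _ => ?_
    rw [single_apply, if_neg]
    rintro ⟨rfl, rfl⟩
    exact hab rfl

/-- The Choi matrix of a completely positive map is positive semidefinite. -/
lemma IsCP.choi_posSemidef {d₁ d₂ : ℕ} {Φ : QOp d₁ →ₗ[ℂ] QOp d₂} (hΦ : IsCP Φ) :
    (Matrix.comp (Fin d₁) (Fin d₁) (Fin d₂) (Fin d₂) ℂ
      (of fun i j => Φ (single i j 1))).PosSemidef := by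
  refine hΦ d₁ (of fun i j => single i j 1) ?_
  convert posSemidef_vecMulVec_self_star
    (fun p : Fin d₁ × Fin d₁ => if p.1 = p.2 then (1 : ℂ) else 0) using 1
  ext ⟨i, a⟩ ⟨j, b⟩
  simp [comp_apply, vecMulVec_apply, single_apply, ← ite_and, and_comm]

/-! ### Adjoints and change of basis -/

lemma heisenberg_apply {d₁ d₂ : ℕ} (Φ : QOp d₁ →ₗ[ℂ] QOp d₂) (A : QOp d₂) (j i : Fin d₁) :
    heisenberg Φ A j i = (Φ (single i j 1) * A).trace := rfl

lemma heisenberg_eq_of_trace {d₁ d₂ : ℕ} {Φ : QOp d₁ →ₗ[ℂ] QOp d₂} {A : QOp d₂} {B : QOp d₁}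
    (h : ∀ ρ, (ρ * B).trace = (Φ ρ * A).trace) : heisenberg Φ A = B := by
  ext j i
  rw [heisenberg_apply, ← h, trace_single_mul, one_smul]

lemma depolarizing_conj {d : ℕ} (t : ℝ) {U : QOp d} (hU : Uᴴ * U = 1) (ρ : QOp d) :
    U * depolarizing d t (Uᴴ * ρ * U) * Uᴴ = depolarizing d t ρ := by
  have hU' : U * Uᴴ = 1 := mul_eq_one_comm.mp hU
  have h1 : U * (Uᴴ * ρ * U) * Uᴴ = ρ := by
    calc _ = (U * Uᴴ) * ρ * (U * Uᴴ) := by simp only [Matrix.mul_assoc]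
      _ = ρ := by rw [hU']; simp
  have h2 : (Uᴴ * ρ * U).trace = ρ.trace := by
    rw [trace_mul_comm, ← Matrix.mul_assoc, hU', Matrix.one_mul]
  rw [depolarizing_apply, depolarizing_apply, Matrix.mul_add, Matrix.add_mul, h2]
  simp only [Matrix.mul_smul, Matrix.smul_mul, h1, Matrix.mul_one, hU']

/-- Depolarizing channels are unitarily covariant, so a unitary may be applied to the meter. -/
lemma Compatible.conj {X : Type*} [Fintype X] {d : ℕ} {M : X → QOp d} {t : ℝ}
    (h : Compatible M (depolarizing d t)) {U : QOp d} (hU : Uᴴ * U = 1) :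
    Compatible (fun x => U * M x * Uᴴ) (depolarizing d t) := by
  obtain ⟨J, ⟨hJ, hΦ⟩, hM, hsum⟩ := h
  have hs : ∑ x, krausMap U ∘ₗ J x ∘ₗ krausMap Uᴴ = depolarizing d t := by
    ext1 ρ
    have : ∑ x, J x (Uᴴ * ρ * U) = depolarizing d t (Uᴴ * ρ * U) := by
      rw [← hsum, LinearMap.sum_apply]
    rw [← depolarizing_conj t hU, ← this]
    simp [krausMap_apply, LinearMap.sum_apply, Matrix.mul_sum, Matrix.sum_mul]
  have hcp : ∀ x, IsCP (krausMap U ∘ₗ J x ∘ₗ krausMap Uᴴ) := fun x =>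
    (isCP_krausMap _).comp ((hJ x).comp (isCP_krausMap _))
  refine ⟨fun x => krausMap U ∘ₗ J x ∘ₗ krausMap Uᴴ, ⟨hcp, .sum _ fun x _ => hcp x, ?_⟩,
    fun x => ?_, hs⟩
  · rw [hs, ← hsum]
    exact hΦ.2
  · refine heisenberg_eq_of_trace fun ρ => ?_
    simp only [LinearMap.comp_apply, krausMap_apply, conjTranspose_conjTranspose, Matrix.mul_one]
    rw [trace_mul_comm (U * _), ← Matrix.mul_assoc Uᴴ, hU, Matrix.one_mul]
    have := trace_mul_heisenberg (J x) (Uᴴ * ρ * U) 1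
    rw [Matrix.mul_one, hM] at this
    rw [← this, ← Matrix.mul_assoc, trace_mul_comm]
    simp only [Matrix.mul_assoc]

/-- The noisy version of the sharp meter of the standard basis. -/
noncomputable def diagonalMeter (d : ℕ) (s : ℝ) (x : Fin d) : QOp d :=
  diagonal fun i => (((if i = x then s else 0) + (1 - s) / d : ℝ) : ℂ)

lemma compatible_noisyMeter_iff {d : ℕ}
    (φ : OrthonormalBasis (Fin d) ℂ (EuclideanSpace ℂ (Fin d))) (s t : ℝ) :
    Compatible (noisyMeter φ s) (depolarizing d t) ↔
      Compatible (diagonalMeter d s) (depolarizing d t) := by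
  let U : QOp d := of fun i y => φ y i
  have hU : Uᴴ * U = 1 := by
    ext x y
    have := orthonormal_iff_ite.mp φ.orthonormal x y
    rw [PiLp.inner_apply] at this
    simp only [mul_apply, conjTranspose_apply, U, of_apply, one_apply, ← this]
    refine Finset.sum_congr rfl fun i _ => ?_
    simp [mul_comm]
  have hU' : U * Uᴴ = 1 := mul_eq_one_comm.mp hU
  have hM : noisyMeter φ s = fun x => U * diagonalMeter d s x * Uᴴ := by
    funext x
    have : diagonalMeter d s x
        = (s : ℂ) • single x x (1 : ℂ) + ((1 - s : ℂ) * (1 / d)) • (1 : QOp d) := by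
      ext i j
      by_cases hij : i = j
      · subst hij
        by_cases hx : i = x
        · subst hx
          simp [diagonalMeter]
          ring
        · simp [diagonalMeter, hx, Ne.symm hx]
          ring
      · simp [diagonalMeter, hij, single_apply]
        rintro rfl rfl
        exact absurd rfl hij
    have h2 : U * single x x (1 : ℂ) * Uᴴ = sharpMeter φ x := by
      ext i j
      simp [mul_apply, single_apply, sharpMeter, vecMulVec_apply, U, ite_and]
    simp only [this, Matrix.mul_add, Matrix.add_mul, Matrix.mul_smul, Matrix.smul_mul,
      Matrix.mul_one, hU', h2, noisyMeter]
  constructor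
  · intro h
    have := h.conj (U := Uᴴ) (by rw [conjTranspose_conjTranspose, hU'])
    convert this using 2 with x
    rw [hM, conjTranspose_conjTranspose]
    calc _ = 1 * diagonalMeter d s x * 1 := by simp
      _ = _ := by rw [← hU]; simp only [Matrix.mul_assoc]
  · intro h
    rw [hM]
    exact h.conj hU

/-! ### Reduction to real matrices -/

/-- Real data `(c, n)` for a joint instrument of the noisy standard basis meter and the
depolarizing channel. The Choi matrices `C x` of such an instrument enter only through the real
part `c x` of their compression to the span of the vectors `e_i ⊗ e_i`, and through their remaining
diagonal entries `n x i j = ⟨e_i ⊗ e_j, C x (e_i ⊗ e_j)⟩`, `i ≠ j`. -/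
def JointData (d : ℕ) (s t : ℝ) : Prop :=
  ∃ (c : Fin d → Matrix (Fin d) (Fin d) ℝ) (n : Fin d → Fin d → Fin d → ℝ),
    (∀ x, (c x).PosSemidef) ∧ (∀ x i j, 0 ≤ n x i j) ∧
    (∀ i j, ∑ x, c x i j = t + if i = j then (1 - t) / d else 0) ∧
    (∀ i j, ∑ x, n x i j = if i = j then 0 else (1 - t) / d) ∧
    ∀ x i, c x i i + ∑ j, n x i j = (if i = x then s else 0) + (1 - s) / d

lemma Matrix.PosSemidef.map_re {ι : Type*} [Fintype ι] {C : Matrix ι ι ℂ} (hC : C.PosSemidef) :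
    (C.map Complex.re).PosSemidef := by
  refine .of_dotProduct_mulVec_nonneg ?_ fun v => ?_
  · ext i j
    have := congrArg Complex.re (hC.1.apply i j)
    simpa using this
  · have := (Complex.le_def.mp (hC.dotProduct_mulVec_nonneg (fun i => (v i : ℂ)))).1
    simpa [dotProduct, mulVec, Complex.re_sum] using this

open scoped MatrixOrder in
lemma Matrix.PosSemidef.map_ofReal {ι : Type*} [Fintype ι] {c : Matrix ι ι ℝ}
    (hc : c.PosSemidef) : (c.map ((↑) : ℝ → ℂ)).PosSemidef := by
  classical
  obtain ⟨B, rfl⟩ := CStarAlgebra.nonneg_iff_eq_star_mul_self.mp hc.nonneg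
  convert posSemidef_conjTranspose_mul_self (B.map ((↑) : ℝ → ℂ)) using 1
  ext i j
  simp [mul_apply, star_eq_conjTranspose]

lemma depolarizing_single_apply {d : ℕ} (t : ℝ) (i j k l : Fin d) :
    depolarizing d t (single i j 1) k l =
      (((if i = k ∧ j = l then t else 0) + if i = j ∧ k = l then (1 - t) / d else 0 : ℝ) : ℂ) := by
  rw [depolarizing_apply]
  by_cases hij : i = j
  · subst hij
    by_cases hkl : k = l
    · subst hkl
      simp [single_apply]
      split_ifs <;> simp <;> ring
    · simp only [Matrix.add_apply, Matrix.smul_apply, single_apply, one_apply, hkl]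
      split_ifs <;> simp_all
  · simp only [Matrix.add_apply, Matrix.smul_apply, single_apply, hij,
      trace_single_eq_of_ne i j (1 : ℂ) hij]
    split_ifs <;> simp_all

lemma JointData.of_compatible {d : ℕ} {s t : ℝ}
    (h : Compatible (diagonalMeter d s) (depolarizing d t)) : JointData d s t := by
  obtain ⟨J, ⟨hJ, -⟩, hM, hsum⟩ := h
  have hC := fun x => (hJ x).choi_posSemidef
  have hs : ∀ i j k l, ∑ x, (J x (single i j 1) k l).re =
      (if i = k ∧ j = l then t else 0) + if i = j ∧ k = l then (1 - t) / d else 0 := by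
    intro i j k l
    have := depolarizing_single_apply t i j k l
    rw [← hsum, LinearMap.sum_apply, Matrix.sum_apply] at this
    rw [← Complex.re_sum, this, Complex.ofReal_re]
  refine ⟨fun x => of fun i j => (J x (single i j 1) i j).re,
    fun x i j => if i = j then 0 else (J x (single i i 1) j j).re, fun x => ?_, fun x i j => ?_,
    fun i j => ?_, fun i j => ?_, fun x i => ?_⟩
  · exact ((hC x).submatrix fun i => (i, i)).map_re
  · dsimp only
    split_ifs
    · exact le_rfl
    · exact (Complex.le_def.mp ((hC x).diag_nonneg (i := (i, j)))).1
  · simp [hs]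
  · by_cases hij : i = j
    · simp [hij]
    · simp [hij, hs]
  · have := congrArg Complex.re (congrFun (congrFun (hM x) i) i)
    rw [heisenberg_apply, Matrix.mul_one, diagonalMeter, diagonal_apply_eq, Complex.ofReal_re,
      trace, Complex.re_sum] at this
    rw [← this, ← Finset.add_sum_erase _ _ (Finset.mem_univ i),
      ← Finset.add_sum_erase _ (fun j => (diag (J x (single i i 1)) j).re) (Finset.mem_univ i)]
    simp only [of_apply, diag_apply, if_true, zero_add]
    congr 1
    exact Finset.sum_congr rfl fun j hj => if_neg (Finset.ne_of_mem_erase hj).symm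

lemma JointData.compatible {d : ℕ} (hd : d ≠ 0) {s t : ℝ} (h : JointData d s t) :
    Compatible (diagonalMeter d s) (depolarizing d t) := by
  obtain ⟨c, n, hc, hn, hcs, hns, hm⟩ := h
  have hd' : (d : ℂ) ≠ 0 := by exact_mod_cast hd
  have happ : ∀ x ρ i j, (schurMap ((c x).map (↑)) + transitionMap (n x)) ρ i j =
      (c x i j : ℂ) * ρ i j + if i = j then ∑ k, (n x k i : ℂ) * ρ k k else 0 := by
    intro x ρ i j
    rw [LinearMap.add_apply, transitionMap_apply (hn x), Matrix.add_apply, diagonal_apply]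
    rfl
  have hcp : ∀ x, IsCP (schurMap ((c x).map (↑)) + transitionMap (n x)) := fun x =>
    (isCP_schurMap (hc x).map_ofReal).add (isCP_transitionMap _)
  have hs : ∑ x, (schurMap ((c x).map (↑)) + transitionMap (n x)) = depolarizing d t := by
    ext1 ρ
    ext i j
    rw [LinearMap.sum_apply, Matrix.sum_apply]
    simp only [happ]
    rw [Finset.sum_add_distrib, ← Finset.sum_mul, ← Complex.ofReal_sum, hcs, depolarizing_apply]
    by_cases hij : i = j
    · subst hij
      simp only [if_true]
      rw [Finset.sum_comm]
      simp only [← Finset.sum_mul, ← Complex.ofReal_sum, hns]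
      rw [← Finset.add_sum_erase _ _ (Finset.mem_univ i), Finset.sum_congr rfl
        (g := fun k => (((1 - t) / d : ℝ) : ℂ) * ρ k k)
        fun k hk => by rw [if_neg (Finset.ne_of_mem_erase hk)], ← Finset.mul_sum]
      have : ρ.trace = ρ i i + ∑ k ∈ Finset.univ.erase i, ρ k k :=
        (Finset.add_sum_erase _ (fun k => ρ k k) (Finset.mem_univ i)).symm
      simp [this]
      ring
    · simp [hij]
  refine ⟨_, ⟨hcp, .sum _ fun x _ => hcp x, fun ρ hρ => ?_⟩, fun x => ?_, hs⟩
  · rw [hs, depolarizing_apply]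
    simp [hρ.2]
    field_simp
    ring
  · refine heisenberg_eq_of_trace fun ρ => ?_
    rw [Matrix.mul_one, diagonalMeter, trace, trace]
    simp only [diag_apply, happ, if_true, mul_diagonal, ← hm, Complex.ofReal_add,
      Complex.ofReal_sum, mul_add, Finset.sum_add_distrib, Finset.mul_sum]
    rw [Finset.sum_comm (γ := Fin d) (f := fun i k => (n x k i : ℂ) * ρ k k)]
    simp only [mul_comm]

lemma compatible_iff_jointData {d : ℕ} (hd : d ≠ 0)
    (φ : OrthonormalBasis (Fin d) ℂ (EuclideanSpace ℂ (Fin d))) (s t : ℝ) :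
    Compatible (noisyMeter φ s) (depolarizing d t) ↔ JointData d s t :=
  (compatible_noisyMeter_iff φ s t).trans ⟨.of_compatible, JointData.compatible hd⟩

/-! ### Constructing joint data -/

lemma sum_ite_eq_zero {d : ℕ} (i : Fin d) (b : ℝ) :
    ∑ j, (if i = j then 0 else b) = ((d : ℝ) - 1) * b := by
  have : ∀ j, (if i = j then 0 else b) = b - if i = j then b else 0 := by
    intro j; split_ifs <;> ring
  simp only [this, Finset.sum_sub_distrib]
  simp
  ring

lemma JointData.convex {d : ℕ} {s₁ s₂ s t : ℝ} (h₁ : JointData d s₁ t) (h₂ : JointData d s₂ t)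
    (hs : s ∈ Set.Icc s₁ s₂) : JointData d s t := by
  rw [← segment_eq_Icc (hs.1.trans hs.2)] at hs
  obtain ⟨α, β, hα, hβ, hαβ, rfl⟩ := hs
  obtain ⟨c₁, n₁, hc₁, hn₁, hcs₁, hns₁, hm₁⟩ := h₁
  obtain ⟨c₂, n₂, hc₂, hn₂, hcs₂, hns₂, hm₂⟩ := h₂
  obtain rfl : β = 1 - α := by linarith
  refine ⟨fun x => α • c₁ x + (1 - α) • c₂ x, fun x i j => α * n₁ x i j + (1 - α) * n₂ x i j,
    fun x => ((hc₁ x).smul hα).add ((hc₂ x).smul hβ), fun x i j => ?_, fun i j => ?_,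
    fun i j => ?_, fun x i => ?_⟩
  · have := hn₁ x i j
    have := hn₂ x i j
    positivity
  · simp only [Matrix.add_apply, Matrix.smul_apply, smul_eq_mul, Finset.sum_add_distrib,
      ← Finset.mul_sum, hcs₁, hcs₂]
    ring
  · simp only [Finset.sum_add_distrib, ← Finset.mul_sum, hns₁, hns₂]
    ring
  · simp only [Matrix.add_apply, Matrix.smul_apply, smul_eq_mul, Finset.sum_add_distrib,
      ← Finset.mul_sum]
    have e₁ := hm₁ x i
    have e₂ := hm₂ x i
    split_ifs at e₁ e₂ ⊢ <;> linear_combination α * e₁ + (1 - α) * e₂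

/-- The `x`-th column of the symmetric matrix with eigenvalue `p` on `𝟙` and `r` on the orthogonal
complement of `𝟙`. For `p² = 1 + (d² - 1) t` and `r² = 1 - t` this matrix, divided by `√d`, is a square
root of `((1 - t) / d) 1 + t 𝟙𝟙ᵀ`; the sign of `r` selects the root. -/
noncomputable def rootVec (d : ℕ) (p r : ℝ) (x i : Fin d) : ℝ :=
  (p - r) / d + if i = x then r else 0

/-- The rank one operators obtained from the columns of a square root of a matrix sum up to this
matrix. -/
lemma sum_rootVec_mul {d : ℕ} (hd : d ≠ 0) {p r t : ℝ} (hp : p ^ 2 = 1 + ((d : ℝ) ^ 2 - 1) * t)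
    (hr : r ^ 2 = 1 - t) (i j : Fin d) :
    ∑ x, (1 / (d : ℝ)) * (rootVec d p r x i * rootVec d p r x j) =
      t + if i = j then (1 - t) / d else 0 := by
  have hd' : (d : ℝ) ≠ 0 := by exact_mod_cast hd
  simp only [rootVec, mul_add, add_mul, Finset.sum_add_distrib, ite_mul, mul_ite, zero_mul,
    mul_zero, Finset.sum_ite_eq, Finset.mem_univ, if_true, Finset.sum_const, Finset.card_univ,
    Fintype.card_fin, nsmul_eq_mul]
  have key : (p ^ 2 - r ^ 2) = d ^ 2 * t := by rw [hp, hr]; ring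
  by_cases hij : i = j
  · subst hij
    simp only [if_true]
    rw [← hr]
    field_simp
    linear_combination key
  · simp only [hij, if_false]
    field_simp
    linear_combination key

lemma posSemidef_rootVec {d : ℕ} (p r : ℝ) (x : Fin d) :
    (of fun i j => (1 / (d : ℝ)) * (rootVec d p r x i * rootVec d p r x j)).PosSemidef := by
  have h := (posSemidef_vecMulVec_self_star (rootVec d p r x)).smul
    (show (0 : ℝ) ≤ 1 / d by positivity)
  convert h using 1
  ext i j
  simp [vecMulVec_apply]

/-- The optimal instrument for the upper bound on `s`: all the weight outside the diagonal subspace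
goes to the outcome `x = i`. -/
lemma jointData_upper {d : ℕ} (hd : 2 ≤ d) {p r s t : ℝ}
    (hp : p ^ 2 = 1 + ((d : ℝ) ^ 2 - 1) * t) (hr : r ^ 2 = 1 - t)
    (hs : (d : ℝ) ^ 2 * s = ((d : ℝ) ^ 2 - 2) * (1 - t) + 2 * (p * r)) : JointData d s t := by
  have hd0 : (d : ℝ) ≠ 0 := by positivity
  have hb : 0 ≤ (1 - t) / d := by rw [← hr]; positivity
  refine ⟨fun x => of fun i j => (1 / (d : ℝ)) * (rootVec d p r x i * rootVec d p r x j),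
    fun x i j => if i = x then if i = j then 0 else (1 - t) / d else 0,
    fun x => posSemidef_rootVec p r x, fun x i j => ?_, sum_rootVec_mul (by omega) hp hr,
    fun i j => by simp, fun x i => ?_⟩
  · dsimp only
    split_ifs <;> first | exact le_rfl | exact hb
  · by_cases hi : i = x
    · simp only [hi, if_true, sum_ite_eq_zero, of_apply, rootVec]
      field_simp
      linear_combination hp + ((d : ℝ) - 1) ^ 2 * hr - ((d : ℝ) - 1) * hs
    · simp only [hi, if_false, of_apply, rootVec, Finset.sum_const_zero]
      field_simp
      linear_combination hp + hr + hs

/-- The instrument for the lower bound on `s`: it arises from the square root with a negative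
eigenvalue on the complement of `𝟙`, and the outcome `x = i` gets no weight outside the diagonal
subspace. -/
lemma jointData_lower {d : ℕ} (hd : 2 ≤ d) {p r s t : ℝ}
    (hp : p ^ 2 = 1 + ((d : ℝ) ^ 2 - 1) * t) (hr : r ^ 2 = 1 - t)
    (hs : (d : ℝ) ^ 2 * s = -2 * (1 - t + p * r)) : JointData d s t := by
  have hd0 : (d : ℝ) ≠ 0 := by positivity
  have hd1 : (d : ℝ) - 1 > 0 := by
    have : (2 : ℝ) ≤ d := by exact_mod_cast hd
    linarith
  have hb : 0 ≤ (1 - t) / d / ((d : ℝ) - 1) := by rw [← hr]; positivity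
  refine ⟨fun x => of fun i j => (1 / (d : ℝ)) * (rootVec d p (-r) x i * rootVec d p (-r) x j),
    fun x i j => if i = x then 0 else if i = j then 0 else (1 - t) / d / ((d : ℝ) - 1),
    fun x => posSemidef_rootVec p (-r) x, fun x i j => ?_,
    sum_rootVec_mul (by omega) hp (by rw [neg_sq, hr]), fun i j => ?_, fun x i => ?_⟩
  · dsimp only
    split_ifs <;> first | exact le_rfl | exact hb
  · rw [sum_ite_eq_zero]
    split_ifs
    · simp
    · field_simp
  · by_cases hi : i = x
    · simp only [hi, if_true, of_apply, rootVec, Finset.sum_const_zero]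
      field_simp
      linear_combination hp + ((d : ℝ) - 1) ^ 2 * hr - ((d : ℝ) - 1) * hs
    · simp only [hi, if_false, of_apply, rootVec, sum_ite_eq_zero]
      field_simp
      linear_combination hp + hr + hs

/-- The quadratic form of the Laplacian of the complete graph on the complement of `x`. -/
lemma sum_vecMulVec_sub {d : ℕ} (x i j : Fin d) :
    (∑ y ∈ Finset.univ.erase x, ∑ z ∈ Finset.univ.erase x,
      vecMulVec (Pi.single y 1 - Pi.single z 1 : Fin d → ℝ)
        (Pi.single y 1 - Pi.single z 1)) i j =
      if i = x ∨ j = x then 0 else 2 * (((d : ℝ) - 1) * (if i = j then 1 else 0) - 1) := by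
  have hd : 1 ≤ d := x.pos
  simp only [Matrix.sum_apply, vecMulVec_apply, Pi.sub_apply, mul_sub, Finset.sum_sub_distrib,
    Pi.single_apply, mul_ite, mul_one, mul_zero, Finset.sum_ite_eq, Finset.mem_erase,
    Finset.mem_univ]
  by_cases hi : i = x <;> by_cases hj : j = x <;> by_cases hij : i = j <;>
    simp_all <;> ring

/-- For `d ≥ 3` and small `t`, the outcome `x` can be excluded completely on the `x`-th basis
state: every diagonal block is a combination of `ζζᵀ` with `ζ = 𝟙 - e_x` and of the Laplacian of the
complete graph on the complement of `x`. -/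
lemma jointData_mOne {d : ℕ} (hd : 3 ≤ d) {t : ℝ} (ht : 0 ≤ 1 + ((d : ℝ) ^ 2 - 1) * t)
    (ht' : t ≤ ((d : ℝ) - 2) / (2 * ((d : ℝ) - 1))) : JointData d (mOne d) t := by
  have h3 : (3 : ℝ) ≤ d := by exact_mod_cast hd
  have hd0 : 0 < (d : ℝ) := by linarith
  have hd1 : 0 < (d : ℝ) - 1 := by linarith
  have hd2 : 0 < (d : ℝ) - 2 := by linarith
  have ht1 : t * (2 * ((d : ℝ) - 1)) ≤ d - 2 := (le_div_iff₀ (by positivity)).mp ht'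
  have ht0 : 0 ≤ 1 - t := by nlinarith
  have hb : 0 ≤ (1 - t) / d / ((d : ℝ) - 1) := by positivity
  -- The weights of the Laplacian and of `ζζᵀ`, determined by the sum of the blocks.
  let q : ℝ := ((1 - t) / d - t / (d - 2)) / (d - 1)
  let w : ℝ := q / (d - 1) + t / (d - 2)
  have hq : 0 ≤ q := by
    refine div_nonneg ?_ hd1.le
    rw [sub_nonneg, div_le_div_iff₀ hd2 hd0]
    linarith
  have hw : 0 ≤ w := by
    have : w = (1 + ((d : ℝ) ^ 2 - 1) * t) / (d * (d - 1) ^ 2) := by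
      simp only [w, q]
      field_simp
      ring
    rw [this]
    positivity
  let c : Fin d → Matrix (Fin d) (Fin d) ℝ := fun x =>
    (q / (2 * (d - 1))) • (∑ y ∈ Finset.univ.erase x, ∑ z ∈ Finset.univ.erase x,
      vecMulVec (Pi.single y 1 - Pi.single z 1 : Fin d → ℝ) (Pi.single y 1 - Pi.single z 1)) +
    w • vecMulVec (fun i => if i = x then (0 : ℝ) else 1) (fun i => if i = x then (0 : ℝ) else 1)
  have hc : ∀ x i j, c x i j = if i = x ∨ j = x then 0 else
      t / (d - 2) + if i = j then q else 0 := by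
    intro x i j
    simp only [c, Matrix.add_apply, Matrix.smul_apply, sum_vecMulVec_sub, smul_eq_mul,
      vecMulVec_apply]
    by_cases hi : i = x
    · simp [hi]
    · by_cases hj : j = x
      · simp [hj]
      · by_cases hij : i = j <;> simp only [hi, hj, hij, if_true, if_false, or_self, w] <;>
          field_simp <;> ring
  refine ⟨c, fun x i j => if i = x then 0 else if i = j then 0 else (1 - t) / d / ((d : ℝ) - 1),
    fun x => ?_, fun x i j => ?_, fun i j => ?_, fun i j => ?_, fun x i => ?_⟩
  · refine .add (.smul (posSemidef_sum _ fun y _ => posSemidef_sum _ fun z _ =>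
      posSemidef_vecMulVec_self_star _) (by positivity))
      (.smul (posSemidef_vecMulVec_self_star _) hw)
  · dsimp only
    split_ifs <;> first | exact le_rfl | exact hb
  · simp only [hc]
    by_cases hij : i = j
    · simp only [hij, if_true, or_self, sum_ite_eq_zero, q]
      field_simp
      ring
    · have : ∀ x, (if i = x ∨ j = x then 0 else t / ((d : ℝ) - 2) + if i = j then q else 0)
          = t / ((d : ℝ) - 2) - (if i = x then t / ((d : ℝ) - 2) else 0)
            - if j = x then t / ((d : ℝ) - 2) else 0 := by
        intro x
        by_cases hi : i = x
        · have hj : j ≠ x := fun hj => hij (hi.trans hj.symm)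
          simp [hi, hj]
        · by_cases hj : j = x <;> simp [hi, hj, hij]
      simp only [this, Finset.sum_sub_distrib]
      simp [hij]
      field_simp
      ring
  · rw [sum_ite_eq_zero]
    split_ifs
    · simp
    · field_simp
  · by_cases hi : i = x
    · simp only [hc, hi, if_true, or_self, Finset.sum_const_zero, mOne]
      field_simp
      ring
    · simp only [hc, hi, if_false, or_self, sum_ite_eq_zero, mOne, q]
      field_simp
      simp
      field_simp
      ring

/-! ### Bounds on joint data -/

lemma Matrix.PosSemidef.quadForm_nonneg {ι : Type*} [Fintype ι] {c : Matrix ι ι ℝ}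
    (hc : c.PosSemidef) (v : ι → ℝ) : 0 ≤ ∑ i, ∑ j, v i * (c i j * v j) := by
  have := hc.dotProduct_mulVec_nonneg v
  simpa [dotProduct, mulVec, Finset.mul_sum] using this

lemma Matrix.PosSemidef.apply_comm {ι : Type*} {c : Matrix ι ι ℝ} (hc : c.PosSemidef)
    (i j : ι) : c i j = c j i := by
  simpa using (hc.1.apply j i)

/-- The quadratic form of `c` at `α 𝟙 + β e_x`. -/
lemma Matrix.PosSemidef.quadForm_const_add_single_nonneg {ι : Type*} [Fintype ι] [DecidableEq ι]
    {c : Matrix ι ι ℝ} (hc : c.PosSemidef) (x : ι) (α β : ℝ) :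
    0 ≤ α ^ 2 * ∑ i, ∑ j, c i j + 2 * α * β * ∑ j, c x j + β ^ 2 * c x x := by
  have h := hc.quadForm_nonneg fun i => α + if i = x then β else 0
  have e : ∑ i, ∑ j, (α + if i = x then β else 0) * (c i j * (α + if j = x then β else 0)) =
      α ^ 2 * ∑ i, ∑ j, c i j + α * β * ∑ j, c x j + α * β * ∑ i, c i x + β ^ 2 * c x x := by
    have hrow : ∀ i, ∑ j, (α + if i = x then β else 0) * (c i j * (α + if j = x then β else 0)) =
        α ^ 2 * ∑ j, c i j + α * β * c i x +
          if i = x then α * β * ∑ j, c i j + β ^ 2 * c i x else 0 := by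
      intro i
      have : ∑ j, c i j * (α + if j = x then β else 0) = (∑ j, c i j) * α + c i x * β := by
        simp [mul_add, Finset.sum_add_distrib, Finset.sum_mul]
      rw [← Finset.mul_sum, this]
      split_ifs <;> ring
    simp only [hrow, Finset.sum_add_distrib, ← Finset.mul_sum, Finset.sum_ite_eq',
      Finset.mem_univ, if_true]
    ring
  have hsym : ∑ i, c i x = ∑ j, c x j := Finset.sum_congr rfl fun i _ => hc.apply_comm i x
  rw [e, hsym] at h
  linarith

lemma Matrix.PosSemidef.two_mul_apply_le {ι : Type*} [Fintype ι] {c : Matrix ι ι ℝ}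
    (hc : c.PosSemidef) (y z : ι) : 2 * c y z ≤ c y y + c z z := by
  have h := (hc.submatrix ![y, z]).quadForm_nonneg ![1, -1]
  have := hc.apply_comm y z
  simp [Fin.sum_univ_two] at h
  linarith

/-- Summing `2 c y z ≤ c y y + c z z` over all `y, z ≠ x`. -/
lemma Matrix.PosSemidef.sum_minors_le {d : ℕ} {c : Matrix (Fin d) (Fin d) ℝ}
    (hc : c.PosSemidef) (x : Fin d) :
    ∑ i, ∑ j, c i j - 2 * ∑ j, c x j + c x x ≤ ((d : ℝ) - 1) * (∑ i, c i i - c x x) := by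
  have hsym : ∑ i, c i x = ∑ j, c x j := Finset.sum_congr rfl fun i _ => hc.apply_comm i x
  have h : ∑ y ∈ Finset.univ.erase x, ∑ z ∈ Finset.univ.erase x, 2 * c y z ≤
      ∑ y ∈ Finset.univ.erase x, ∑ z ∈ Finset.univ.erase x, (c y y + c z z) :=
    Finset.sum_le_sum fun y _ => Finset.sum_le_sum fun z _ => hc.two_mul_apply_le y z
  have hcard : ((Finset.univ.erase x).card : ℝ) = d - 1 := by
    rw [Finset.card_erase_of_mem (Finset.mem_univ x), Finset.card_univ, Fintype.card_fin,
      Nat.cast_sub (show 1 ≤ d from x.pos), Nat.cast_one]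
  simp only [Finset.sum_add_distrib, Finset.sum_const, nsmul_eq_mul, ← Finset.mul_sum, hcard] at h
  simp only [Finset.sum_erase_eq_sub (Finset.mem_univ x), Finset.sum_sub_distrib, hsym] at h
  linarith

/-- What joint data imply after summing over the outcomes. With `u x = d e_x - 𝟙`, the numbers
`P = 1 + (d² - 1) t`, `K` and `B` are the sums over `x` of the values of the form `c x` at
`(𝟙, 𝟙)`, `(𝟙, u x)` and `(u x, u x)`, so that `P + 2 K + B` is the sum of its values at
`(d e_x, d e_x)`. -/
lemma JointData.exists_bounds {d : ℕ} (hd : 2 ≤ d) {s t : ℝ} (h : JointData d s t) :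
    ∃ K B N : ℝ, 0 ≤ N ∧ N ≤ ((d : ℝ) - 1) * (1 - t) ∧
      K ^ 2 ≤ (1 + ((d : ℝ) ^ 2 - 1) * t) * B ∧ 0 ≤ B ∧ B ≤ ((d : ℝ) - 1) ^ 2 * (1 - t) ∧
      (d = 2 → B = 1 - t) ∧
      (d : ℝ) ^ 2 * (1 + ((d : ℝ) - 1) * s) =
        1 + ((d : ℝ) ^ 2 - 1) * t + 2 * K + B + (d : ℝ) ^ 2 * N := by
  obtain ⟨c, n, hc, hn, hcs, hns, hm⟩ := h
  have hd0 : (d : ℝ) ≠ 0 := by positivity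
  have hS : ∑ x, ∑ i, ∑ j, c x i j = 1 + ((d : ℝ) ^ 2 - 1) * t := by
    rw [Finset.sum_comm]
    have : ∀ i, ∑ x, ∑ j, c x i j = d * t + (1 - t) / d := by
      intro i
      rw [Finset.sum_comm]
      simp [hcs, Finset.sum_add_distrib]
    simp only [this, Finset.sum_const, Finset.card_univ, Fintype.card_fin, nsmul_eq_mul]
    field_simp
    ring
  have hT : ∑ x, ∑ i, c x i i = 1 + ((d : ℝ) - 1) * t := by
    rw [Finset.sum_comm]
    simp only [hcs, if_true, Finset.sum_const, Finset.card_univ, Fintype.card_fin, nsmul_eq_mul]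
    field_simp
    ring
  set R := ∑ x, ∑ j, c x x j with hR
  set F := ∑ x, c x x x with hF
  have hquad : ∀ α β : ℝ,
      0 ≤ α ^ 2 * (1 + ((d : ℝ) ^ 2 - 1) * t) + 2 * α * β * R + β ^ 2 * F := by
    intro α β
    have := Finset.sum_nonneg fun x (_ : x ∈ Finset.univ) =>
      (hc x).quadForm_const_add_single_nonneg x α β
    simpa only [Finset.sum_add_distrib, ← Finset.mul_sum, hS] using this
  have hRF : R ^ 2 ≤ (1 + ((d : ℝ) ^ 2 - 1) * t) * F := by
    have h := discrim_le_zero (a := F) (b := 2 * R) (c := 1 + ((d : ℝ) ^ 2 - 1) * t)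
      fun y => by have := hquad 1 y; linarith
    rw [discrim] at h
    linarith
  have hminors : 1 + ((d : ℝ) ^ 2 - 1) * t - 2 * R + F ≤
      ((d : ℝ) - 1) * (1 + ((d : ℝ) - 1) * t - F) := by
    have := Finset.sum_le_sum fun x (_ : x ∈ Finset.univ) => (hc x).sum_minors_le x
    simpa only [Finset.sum_add_distrib, Finset.sum_sub_distrib, ← Finset.mul_sum, hS, hT] using this
  refine ⟨d * R - (1 + ((d : ℝ) ^ 2 - 1) * t),
    (d : ℝ) ^ 2 * F - 2 * d * R + (1 + ((d : ℝ) ^ 2 - 1) * t), ∑ x, ∑ j, n x x j,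
    Finset.sum_nonneg fun x _ => Finset.sum_nonneg fun j _ => hn x x j, ?_, ?_, ?_, ?_, ?_, ?_⟩
  · calc ∑ x, ∑ j, n x x j ≤ ∑ x : Fin d, ∑ j, if x = j then 0 else (1 - t) / d :=
          Finset.sum_le_sum fun x _ => Finset.sum_le_sum fun j _ => by
            rw [← hns]
            exact Finset.single_le_sum (f := fun y => n y x j) (fun y _ => hn y x j)
              (Finset.mem_univ x)
      _ = _ := by
          simp only [sum_ite_eq_zero, Finset.sum_const, Finset.card_univ, Fintype.card_fin,
            nsmul_eq_mul]
          field_simp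
  · linarith [mul_le_mul_of_nonneg_left hRF (sq_nonneg (d : ℝ))]
  · have := hquad (-1) d
    linarith
  · linarith [mul_le_mul_of_nonneg_left hminors (Nat.cast_nonneg (α := ℝ) d)]
  · rintro rfl
    -- In dimension two there is only one index different from `x`, and `sum_minors_le` is sharp.
    simp only [Fin.sum_univ_two] at hS hT hR hF
    have := hc 0 |>.apply_comm 0 1
    have := hc 1 |>.apply_comm 0 1
    push_cast at *
    linarith
  · have := Finset.sum_congr rfl fun x (_ : x ∈ Finset.univ) => hm x x
    simp only [if_true, Finset.sum_add_distrib, Finset.sum_const, Finset.card_univ,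
      Fintype.card_fin, nsmul_eq_mul] at this
    have e : (d : ℝ) * s + d * ((1 - s) / d) = 1 + ((d : ℝ) - 1) * s := by
      field_simp
      ring
    rw [e] at this
    rw [← this]
    ring

lemma JointData.upper_bound {d : ℕ} (hd : 2 ≤ d) {s t : ℝ} (h : JointData d s t)
    (ht : 0 ≤ 1 + ((d : ℝ) ^ 2 - 1) * t) (ht1 : t ≤ 1) :
    (d : ℝ) ^ 2 * s ≤ ((d : ℝ) ^ 2 - 2) * (1 - t) +
      2 * (√(1 + ((d : ℝ) ^ 2 - 1) * t) * √(1 - t)) := by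
  obtain ⟨K, B, N, hN, hN', hK, hB, hB', -, he⟩ := h.exists_bounds hd
  have hd1 : 0 < (d : ℝ) - 1 := by
    have : (2 : ℝ) ≤ d := by exact_mod_cast hd
    linarith
  have ht0 : 0 ≤ 1 - t := by linarith
  have hK' : K ≤ √(1 + ((d : ℝ) ^ 2 - 1) * t) * (((d : ℝ) - 1) * √(1 - t)) := by
    refine le_of_sq_le_sq ?_ (by positivity)
    rw [mul_pow, mul_pow, Real.sq_sqrt ht, Real.sq_sqrt ht0]
    exact hK.trans (mul_le_mul_of_nonneg_left hB' ht)
  refine le_of_mul_le_mul_left ?_ hd1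
  linarith [mul_le_mul_of_nonneg_left hN' (sq_nonneg (d : ℝ))]

lemma JointData.lower_bound {d : ℕ} (hd : 2 ≤ d) {s t : ℝ} (h : JointData d s t)
    (ht : 0 ≤ 1 + ((d : ℝ) ^ 2 - 1) * t) (ht1 : t ≤ 1)
    (htd : d = 2 ∨ ((d : ℝ) - 2) / (2 * ((d : ℝ) - 1)) ≤ t) :
    -2 * (1 - t + √(1 + ((d : ℝ) ^ 2 - 1) * t) * √(1 - t)) ≤ (d : ℝ) ^ 2 * s := by
  obtain ⟨K, B, N, hN, hN', hK, hB, hB', hB2, he⟩ := h.exists_bounds hd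
  have hd1 : 0 < (d : ℝ) - 1 := by
    have : (2 : ℝ) ≤ d := by exact_mod_cast hd
    linarith
  have ht0 : 0 ≤ 1 - t := by linarith
  set p := √(1 + ((d : ℝ) ^ 2 - 1) * t) with hp
  set r := √(1 - t) with hr
  have hp2 : p ^ 2 = 1 + ((d : ℝ) ^ 2 - 1) * t := Real.sq_sqrt ht
  have hr2 : r ^ 2 = 1 - t := Real.sq_sqrt ht0
  have hp0 : 0 ≤ p := Real.sqrt_nonneg _
  have hr0 : 0 ≤ r := Real.sqrt_nonneg _
  have hb2 : √B ^ 2 = B := Real.sq_sqrt hB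
  have hb0 : 0 ≤ √B := Real.sqrt_nonneg _
  have hK' : -(p * √B) ≤ K := by
    refine neg_le_of_neg_le (le_of_sq_le_sq ?_ (by positivity))
    rw [neg_sq, mul_pow, hp2, hb2]
    exact hK
  -- The function `b ↦ (p - b) ^ 2` decreases up to `b = p`.
  have hsq : (p - (d - 1) * r) ^ 2 ≤ (p - √B) ^ 2 := by
    rcases htd with rfl | htd
    · rw [hB2 rfl]
      norm_num [hr]
    · have h1 : √B ≤ (d - 1) * r := by
        refine le_of_sq_le_sq ?_ (by positivity)
        rw [hb2, mul_pow, hr2]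
        exact hB'
      have h2 : (d - 1) * r ≤ p := by
        refine le_of_sq_le_sq ?_ hp0
        rw [mul_pow, hr2, hp2]
        rw [div_le_iff₀ (by positivity)] at htd
        linarith [mul_le_mul_of_nonneg_left htd (Nat.cast_nonneg (α := ℝ) d)]
      exact pow_le_pow_left₀ (by linarith) (by linarith) 2
  refine le_of_mul_le_mul_left ?_ hd1
  have h3 : (p - √B) ^ 2 ≤ p ^ 2 + 2 * K + B := by
    rw [sub_sq, hb2]
    linarith
  have h4 : 0 ≤ (d : ℝ) ^ 2 * N := by positivity
  have h5 : (p - (d - 1) * r) ^ 2 = p ^ 2 - 2 * (d - 1) * (p * r) + (d - 1) ^ 2 * r ^ 2 := by ring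
  rw [h5] at hsq
  rw [hp2, hr2] at hsq
  rw [hp2] at h3
  linarith

/-! ### The compatibility region -/

lemma jointData_iff {d : ℕ} (hd : 2 ≤ d) {s t : ℝ} (hs : s ∈ Set.Icc (mOne d) 1)
    (ht : t ∈ Set.Icc (mTwo d) 1) : JointData d s t ↔
        -2 * (1 - tD d t +
            √((1 - (d : ℝ) ^ 2) * tD d t ^ 2 + ((d : ℝ) ^ 2 - 2) * tD d t + 1))
          ≤ (d : ℝ) ^ 2 * s ∧
        (d : ℝ) ^ 2 * s ≤ ((d : ℝ) ^ 2 - 2) * (1 - t) +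
          2 * √((1 - (d : ℝ) ^ 2) * t ^ 2 + ((d : ℝ) ^ 2 - 2) * t + 1) := by
  obtain ⟨hs0, hs1⟩ := hs
  obtain ⟨ht0, ht1⟩ := ht
  have h2 : (2 : ℝ) ≤ d := by exact_mod_cast hd
  have hd0 : 0 < (d : ℝ) := by linarith
  have hd1 : 0 < (d : ℝ) - 1 := by linarith
  have hd1' : (d : ℝ) - 1 ≠ 0 := hd1.ne'
  have hdd : 0 < (d : ℝ) ^ 2 - 1 := by nlinarith
  have hP : 0 ≤ 1 + ((d : ℝ) ^ 2 - 1) * t := by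
    rw [mTwo, div_le_iff₀ hdd] at ht0
    linarith
  have hr : 0 ≤ 1 - t := by linarith
  have hroot : ∀ u : ℝ, (1 - (d : ℝ) ^ 2) * u ^ 2 + ((d : ℝ) ^ 2 - 2) * u + 1 =
      (1 + ((d : ℝ) ^ 2 - 1) * u) * (1 - u) := fun u => by ring
  have hp2 := Real.sq_sqrt hP
  have hr2 := Real.sq_sqrt hr
  have hupper : ∀ {s₁ : ℝ}, JointData d s₁ t → (d : ℝ) ^ 2 * s ≤ ((d : ℝ) ^ 2 - 2) * (1 - t) +
      2 * (√(1 + ((d : ℝ) ^ 2 - 1) * t) * √(1 - t)) → s₁ ≤ s → JointData d s t := by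
    intro s₁ h₁ hle hs₁
    refine h₁.convex (jointData_upper hd hp2 hr2 (mul_div_cancel₀ _ (pow_ne_zero 2 hd0.ne')))
      ⟨hs₁, ?_⟩
    rw [le_div_iff₀ (by positivity)]
    linarith
  rw [hroot, hroot, Real.sqrt_mul hP]
  by_cases htd : 3 ≤ d ∧ t ≤ ((d : ℝ) - 2) / (2 * ((d : ℝ) - 1))
  · -- Here the lower bound is the bound `m₁ ≤ s`.
    have hval : -2 * (1 - tD d t + √((1 + ((d : ℝ) ^ 2 - 1) * tD d t) * (1 - tD d t))) =
        (d : ℝ) ^ 2 * mOne d := by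
      have : (1 + ((d : ℝ) ^ 2 - 1) * tD d t) * (1 - tD d t) = (d / 2) ^ 2 := by
        rw [tD, if_pos htd]
        field_simp
        ring
      rw [this, Real.sqrt_sq (by positivity), tD, if_pos htd, mOne]
      field_simp
      ring
    rw [hval]
    exact ⟨fun h => ⟨mul_le_mul_of_nonneg_left hs0 (sq_nonneg _), h.upper_bound hd hP ht1⟩,
      fun h => hupper (jointData_mOne htd.1 hP htd.2) h.2 hs0⟩
  · rw [tD, if_neg htd, Real.sqrt_mul hP]
    have htd' : d = 2 ∨ ((d : ℝ) - 2) / (2 * ((d : ℝ) - 1)) ≤ t := by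
      by_cases h3 : 3 ≤ d
      · exact .inr (le_of_not_ge fun h => htd ⟨h3, h⟩)
      · exact .inl (by omega)
    refine ⟨fun h => ⟨h.lower_bound hd hP ht1 htd', h.upper_bound hd hP ht1⟩, fun h => ?_⟩
    refine hupper (jointData_lower hd hp2 hr2 (mul_div_cancel₀ _ (pow_ne_zero 2 hd0.ne'))) h.2 ?_
    rw [div_le_iff₀ (by positivity)]
    linarith [h.1]

theorem mainTheorem2 (d : ℕ) (hd : 2 ≤ d) (φ : OrthonormalBasis (Fin d) ℂ (EuclideanSpace ℂ (Fin d))) :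
    (∀ s t : ℝ, s ∈ Set.Icc (mOne d) 1 → t ∈ Set.Icc (mTwo d) 1 →
      (Compatible (noisyMeter φ s) (depolarizing d t) ↔
        -2 * (1 - tD d t +
            √((1 - (d : ℝ) ^ 2) * tD d t ^ 2 + ((d : ℝ) ^ 2 - 2) * tD d t + 1))
          ≤ (d : ℝ) ^ 2 * s ∧
        (d : ℝ) ^ 2 * s ≤ ((d : ℝ) ^ 2 - 2) * (1 - t) +
          2 * √((1 - (d : ℝ) ^ 2) * t ^ 2 + ((d : ℝ) ^ 2 - 2) * t + 1))) ∧
    (Compatible (noisyMeter φ (mOne d)) (depolarizing d (mTwo d)) ↔ 3 ≤ d) := by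
  have hd0 : d ≠ 0 := by omega
  refine ⟨fun s t hs ht => (compatible_iff_jointData hd0 φ s t).trans (jointData_iff hd hs ht),
    ?_⟩
  have h2 : (2 : ℝ) ≤ d := by exact_mod_cast hd
  have hd1 : 0 < (d : ℝ) - 1 := by linarith
  have hdd : 0 < (d : ℝ) ^ 2 - 1 := by nlinarith
  have hP : 1 + ((d : ℝ) ^ 2 - 1) * mTwo d = 0 := by
    rw [mTwo]
    field_simp
    ring
  have hm2 : mTwo d ≤ 0 := div_nonpos_of_nonpos_of_nonneg (by norm_num) hdd.le
  rw [compatible_iff_jointData hd0]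
  constructor
  · intro h
    by_contra h3
    obtain rfl : d = 2 := by omega
    have := h.lower_bound hd hP.ge (by linarith) (.inl rfl)
    rw [hP] at this
    norm_num [mOne, mTwo] at this
  · intro h3
    exact jointData_mOne h3 hP.ge (hm2.trans (div_nonneg (by linarith) (by linarith)))
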